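/- For positive integers $k$, $w$, $t$, a $(k,wt;w)$-cyclic holey difference matrix, briefly a $(k,wt;w)$-CHDM, is a $k\times w(t-1)$ matrix $D=(d_{ij})$ with entries from $\mathbb{Z}_{wt}$ such that for any two distinct rows $x$ and $y$ the list of differences $\{d_{xj}-d_{yj} : 1\le j\le w(t-1)\}$ contains each element of $\mathbb{Z}_{wt}\setminus S$ exactly once and contains no element of $S$, where $S=\{0,t,\ldots,(w-1)t\}$ is the subgroup of order $w$ in $\mathbb{Z}_{wt}$. **Lemma.** There exists a $(3,2^xt;2^x)$-CHDM for any integers $x\ge 3$ and $t\ge 5$. -/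

import Mathlib

/-- The subset `S = {0, t, 2t, …, (w-1)t}` of `ℤ/(wt)ℤ`; for `w, t ≥ 1` it is the subgroup of
order `w`. -/
def holeSet (w t : ℕ) : Set (ZMod (w * t)) :=
  {d | ∃ i : ℕ, i < w ∧ d = ((i * t : ℕ) : ZMod (w * t))}

/-- `D` is a `(k, wt; w)`-cyclic holey difference matrix: a `k × w(t-1)` matrix over `ℤ/(wt)ℤ` such
that, for any two distinct rows `x` and `y`, the list of differences `D x j - D y j` contains each
element outside `holeSet w t` exactly once, and no element of `holeSet w t`. -/
def IsCHDM (k w t : ℕ) (D : Matrix (Fin k) (Fin (w * (t - 1))) (ZMod (w * t))) : Prop :=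
  ∀ x y : Fin k, x ≠ y →
    (∀ d : ZMod (w * t), d ∉ holeSet w t → ∃! j, D x j - D y j = d) ∧
    (∀ d : ZMod (w * t), d ∈ holeSet w t → ∀ j, D x j - D y j ≠ d)

/-! Normalise the rows to `0, X, -Y`: it suffices that `X`, `Y` and `X + Y` are injective modulo `w
* t` and avoid multiples of `t`; counting then gives every required difference exactly once.

Write `w = 2 * m` with `m` even and index columns by pairs `(d, i)` with `0 < |d| < t` and `0 ≤ i <
m`. A labelling splits `d` as `a d - (a d - d)`. Put `X = a d - g + t * (i + m * c d)` and `Y = -(a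
d - d - g) + t * (i + m * c' d)`. Omitting the label `g` keeps both off the hole. A residue modulo
`t` comes from at most two `d`, which `c` or `c'` places in different halves of the `2 * m` levels.
Finally `X + Y = d + t * (2 * i + m * (c d + c' d))` is `d` modulo `2 * t`, which determines `d` and
then `i`.

The labellings are digraphs on the `t - 1` labels other than `g`, with in- and out-degree 2 and one
arc for each `d`. -/

/-- A labelling of the nonzero integers `d` in `(-t, t)` as differences of two elements of
`[0, t) \ {g}`, where each element is used at most twice (distinguished by `c`) as a minuend and at
most twice (distinguished by `c'`) as a subtrahend. -/
structure IsGracefulLabelling (t g : ℤ) (a c c' : ℤ → ℤ) : Prop where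
  minuend : ∀ d, -t < d → d < t → d ≠ 0 → 0 ≤ a d ∧ a d < t ∧ a d ≠ g ∧ (c d = 0 ∨ c d = 1)
  subtrahend : ∀ d, -t < d → d < t → d ≠ 0 →
    0 ≤ a d - d ∧ a d - d < t ∧ a d - d ≠ g ∧ (c' d = 0 ∨ c' d = 1)
  minuend_inj : ∀ d e, -t < d → d < t → d ≠ 0 → -t < e → e < t → e ≠ 0 →
    a d = a e → c d = c e → d = e
  subtrahend_inj : ∀ d e, -t < d → d < t → d ≠ 0 → -t < e → e < t → e ≠ 0 →
    a d - d = a e - e → c' d = c' e → d = e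
  range_pos : 0 ≤ g ∧ g < t

/-! ### Explicit zigzag labellings for each residue class of `t`. -/

/-- The triples `(a d, c d, c' d)` of a graceful labelling with `t = 4 * k + 1`, `g = k`. -/
inductive LabelRelationFourMulAddOne (k d a c c' : ℤ) : Prop
  | piece_a (i : ℤ) (hl : 0 ≤ i) (hu : i < k) (hd : d = 4 * k - 2 * i) (ha : a = 4 * k - i)
      (hc : c = 0) (hc' : c' = 0)
  | piece_b (i : ℤ) (hl : 0 ≤ i) (hu : i < k) (hd : d = 4 * k - 1 - 2 * i) (ha : a = 4 * k - 1 - i)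
      (hc : c = 1) (hc' : c' = 1)
  | piece_c (hd : d = 2 * k) (ha : a = 4 * k) (hc : c = 1) (hc' : c' = 1)
  | piece_d (i : ℤ) (hl : k < i) (hu : i ≤ 2 * k) (hd : d = 4 * k + 1 - 2 * i) (ha : a = 4 * k + 1 - i)
      (hc : c = 0) (hc' : c' = 0)
  | piece_e (i : ℤ) (hl : k < i) (hu : i < 2 * k) (hd : d = 4 * k - 2 * i) (ha : a = 4 * k - i)
      (hc : c = 1) (hc' : c' = 1)
  | piece_f (i : ℤ) (hl : 0 ≤ i) (hu : i < k) (hd : d = 2 * i - 4 * k) (ha : a = i)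
      (hc : c = 0) (hc' : c' = 0)
  | piece_g (i : ℤ) (hl : 0 ≤ i) (hu : i < k) (hd : d = 2 * i + 1 - 4 * k) (ha : a = i)
      (hc : c = 1) (hc' : c' = 1)
  | piece_h (hd : d = -2 * k) (ha : a = 2 * k) (hc : c = 1) (hc' : c' = 1)
  | piece_i (i : ℤ) (hl : k < i) (hu : i ≤ 2 * k) (hd : d = 2 * i - 4 * k - 1) (ha : a = i)
      (hc : c = 0) (hc' : c' = 0)
  | piece_j (i : ℤ) (hl : k < i) (hu : i < 2 * k) (hd : d = 2 * i - 4 * k) (ha : a = i)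
      (hc : c = 1) (hc' : c' = 1)

/-- The positive `d` trace a graceful cycle of length `4 * k`: the zigzag `4k, 0, 4k-1, 1, …` jumps
over the label `k`, and the edge `{4k, 2k}` closes it. The negative `d` are the same edges reversed.
-/
theorem exists_gracefulLabelling_four_mul_add_one (k : ℤ) (hk : 1 ≤ k) :
    ∃ g a c c', IsGracefulLabelling (4 * k + 1) g a c c' := by
  have hex : ∀ d, -(4 * k + 1) < d → d < 4 * k + 1 → d ≠ 0 → ∃ a c c', LabelRelationFourMulAddOne k d a c c' := by
    intro d h1 h2 h3
    by_contra! hno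
    -- Each piece rules out a range and parity of `d`, its index `i` being solved from the formula
    -- for `d`; together they exhaust all `d`.
    have h_piece_a : ¬(2 * k < d ∧ d % 2 = 0) := fun _ =>
      hno _ _ _ (.piece_a ((4 * k - d) / 2) (by omega) (by omega) (by omega) rfl rfl rfl)
    have h_piece_b : ¬(2 * k < d ∧ d % 2 = 1) := fun _ =>
      hno _ _ _ (.piece_b ((4 * k - 1 - d) / 2) (by omega) (by omega) (by omega) rfl rfl rfl)
    have h_piece_c : ¬(d = 2 * k) := fun _ =>
      hno _ _ _ (.piece_c (by omega) rfl rfl rfl)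
    have h_piece_d : ¬(0 < d ∧ d < 2 * k ∧ d % 2 = 1) := fun _ =>
      hno _ _ _ (.piece_d ((4 * k + 1 - d) / 2) (by omega) (by omega) (by omega) rfl rfl rfl)
    have h_piece_e : ¬(0 < d ∧ d < 2 * k ∧ d % 2 = 0) := fun _ =>
      hno _ _ _ (.piece_e ((4 * k - d) / 2) (by omega) (by omega) (by omega) rfl rfl rfl)
    have h_piece_f : ¬(d < -2 * k ∧ d % 2 = 0) := fun _ =>
      hno _ _ _ (.piece_f ((4 * k + d) / 2) (by omega) (by omega) (by omega) rfl rfl rfl)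
    have h_piece_g : ¬(d < -2 * k ∧ d % 2 = 1) := fun _ =>
      hno _ _ _ (.piece_g ((4 * k - 1 + d) / 2) (by omega) (by omega) (by omega) rfl rfl rfl)
    have h_piece_h : ¬(d = -2 * k) := fun _ =>
      hno _ _ _ (.piece_h (by omega) rfl rfl rfl)
    have h_piece_i : ¬(d < 0 ∧ -2 * k < d ∧ d % 2 = 1) := fun _ =>
      hno _ _ _ (.piece_i ((4 * k + 1 + d) / 2) (by omega) (by omega) (by omega) rfl rfl rfl)
    have h_piece_j : ¬(d < 0 ∧ -2 * k < d ∧ d % 2 = 0) := fun _ =>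
      hno _ _ _ (.piece_j ((4 * k + d) / 2) (by omega) (by omega) (by omega) rfl rfl rfl)
    clear hno
    omega
  choose! a c c' h using hex
  refine ⟨k, a, c, c', ?_, ?_, ?_, ?_, by omega⟩
  · intro d h1 h2 h3
    cases h d h1 h2 h3 <;> omega
  · intro d h1 h2 h3
    cases h d h1 h2 h3 <;> omega
  · intro d e h1 h2 h3 h1' h2' h3' hae hce
    cases h d h1 h2 h3 <;> cases h e h1' h2' h3' <;> omega
  · intro d e h1 h2 h3 h1' h2' h3' hae hce
    cases h d h1 h2 h3 <;> cases h e h1' h2' h3' <;> omega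

/-- The triples `(a d, c d, c' d)` of a graceful labelling with `t = 4 * k + 3`, `g = k + 1`. -/
inductive LabelRelationFourMulAddThree (k d a c c' : ℤ) : Prop
  | piece_a (i : ℤ) (hl : 0 ≤ i) (hu : i ≤ k) (hd : d = 4 * k + 2 - 2 * i) (ha : a = 4 * k + 2 - i)
      (hc : c = 0) (hc' : c' = 0)
  | piece_b (i : ℤ) (hl : 0 ≤ i) (hu : i ≤ k) (hd : d = 4 * k + 1 - 2 * i) (ha : a = 4 * k + 1 - i)
      (hc : c = 1) (hc' : c' = 1)
  | piece_c (hd : d = 2 * k) (ha : a = 4 * k + 2) (hc : c = 1) (hc' : c' = 0)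
  | piece_d (i : ℤ) (hl : k + 2 ≤ i) (hu : i ≤ 2 * k + 1) (hd : d = 4 * k + 3 - 2 * i) (ha : a = 4 * k + 3 - i)
      (hc : c = 0) (hc' : c' = 0)
  | piece_e (i : ℤ) (hl : k + 2 ≤ i) (hu : i ≤ 2 * k) (hd : d = 4 * k + 2 - 2 * i) (ha : a = 4 * k + 2 - i)
      (hc : c = 1) (hc' : c' = 1)
  | piece_f (i : ℤ) (hl : 0 ≤ i) (hu : i ≤ k) (hd : d = 2 * i - 4 * k - 2) (ha : a = i)
      (hc : c = 0) (hc' : c' = 0)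
  | piece_g (i : ℤ) (hl : 0 ≤ i) (hu : i < k) (hd : d = 2 * i - 4 * k - 1) (ha : a = i)
      (hc : c = 1) (hc' : c' = 1)
  | piece_h (hd : d = -2 * k - 1) (ha : a = 2 * k + 1) (hc : c = 1) (hc' : c' = 1)
  | piece_i (hd : d = -2 * k) (ha : a = k) (hc : c = 1) (hc' : c' = 1)
  | piece_j (hd : d = 1 - 2 * k) (ha : a = k + 2) (hc : c = 0) (hc' : c' = 1)
  | piece_k (i : ℤ) (hl : k + 3 ≤ i) (hu : i ≤ 2 * k + 1) (hd : d = 2 * i - 4 * k - 4) (ha : a = i)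
      (hc : c = 0) (hc' : c' = 0)
  | piece_l (i : ℤ) (hl : k + 2 ≤ i) (hu : i ≤ 2 * k) (hd : d = 2 * i - 4 * k - 1) (ha : a = i)
      (hc : c = 1) (hc' : c' = 1)

/-- Reversing a 2-regular graph is impossible here: signed differences around cycles sum to zero,
but `1 + … + (4k+2)` is odd. The negative arcs instead follow a modified zigzag, and only the two
halves together have all degrees 2. -/
theorem exists_gracefulLabelling_four_mul_add_three (k : ℤ) (hk : 1 ≤ k) :
    ∃ g a c c', IsGracefulLabelling (4 * k + 3) g a c c' := by
  have hex : ∀ d, -(4 * k + 3) < d → d < 4 * k + 3 → d ≠ 0 → ∃ a c c', LabelRelationFourMulAddThree k d a c c' := by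
    intro d h1 h2 h3
    by_contra! hno
    have h_piece_a : ¬(2 * k < d ∧ d % 2 = 0) := fun _ =>
      hno _ _ _ (.piece_a ((4 * k + 2 - d) / 2) (by omega) (by omega) (by omega) rfl rfl rfl)
    have h_piece_b : ¬(2 * k < d ∧ d % 2 = 1) := fun _ =>
      hno _ _ _ (.piece_b ((4 * k + 1 - d) / 2) (by omega) (by omega) (by omega) rfl rfl rfl)
    have h_piece_c : ¬(d = 2 * k) := fun _ =>
      hno _ _ _ (.piece_c (by omega) rfl rfl rfl)
    have h_piece_d : ¬(0 < d ∧ d < 2 * k ∧ d % 2 = 1) := fun _ =>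
      hno _ _ _ (.piece_d ((4 * k + 3 - d) / 2) (by omega) (by omega) (by omega) rfl rfl rfl)
    have h_piece_e : ¬(0 < d ∧ d < 2 * k ∧ d % 2 = 0) := fun _ =>
      hno _ _ _ (.piece_e ((4 * k + 2 - d) / 2) (by omega) (by omega) (by omega) rfl rfl rfl)
    have h_piece_f : ¬(d < -2 * k ∧ d % 2 = 0) := fun _ =>
      hno _ _ _ (.piece_f ((4 * k + 2 + d) / 2) (by omega) (by omega) (by omega) rfl rfl rfl)
    have h_piece_g : ¬(d < -2 * k - 1 ∧ d % 2 = 1) := fun _ =>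
      hno _ _ _ (.piece_g ((4 * k + 1 + d) / 2) (by omega) (by omega) (by omega) rfl rfl rfl)
    have h_piece_h : ¬(d = -2 * k - 1) := fun _ =>
      hno _ _ _ (.piece_h (by omega) rfl rfl rfl)
    have h_piece_i : ¬(d = -2 * k) := fun _ =>
      hno _ _ _ (.piece_i (by omega) rfl rfl rfl)
    have h_piece_j : ¬(d = 1 - 2 * k) := fun _ =>
      hno _ _ _ (.piece_j (by omega) rfl rfl rfl)
    have h_piece_k : ¬(d < 0 ∧ 1 - 2 * k < d ∧ d % 2 = 0) := fun _ =>
      hno _ _ _ (.piece_k ((4 * k + 4 + d) / 2) (by omega) (by omega) (by omega) rfl rfl rfl)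
    have h_piece_l : ¬(d < 0 ∧ 1 - 2 * k < d ∧ d % 2 = 1) := fun _ =>
      hno _ _ _ (.piece_l ((4 * k + 1 + d) / 2) (by omega) (by omega) (by omega) rfl rfl rfl)
    clear hno
    omega
  choose! a c c' h using hex
  refine ⟨k + 1, a, c, c', ?_, ?_, ?_, ?_, by omega⟩
  · intro d h1 h2 h3
    cases h d h1 h2 h3 <;> omega
  · intro d h1 h2 h3
    cases h d h1 h2 h3 <;> omega
  · intro d e h1 h2 h3 h1' h2' h3' hae hce
    cases h d h1 h2 h3 <;> cases h e h1' h2' h3' <;> omega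
  · intro d e h1 h2 h3 h1' h2' h3' hae hce
    cases h d h1 h2 h3 <;> cases h e h1' h2' h3' <;> omega

/-- The triples `(a d, c d, c' d)` of a graceful labelling with `t = 2 * k`, `g = k`. -/
inductive LabelRelationTwoMul (k d a c c' : ℤ) : Prop
  | piece_a (hd : d = 2 * k - 1) (ha : a = 2 * k - 1) (hc : c = 0) (hc' : c' = 1)
  | piece_b (i : ℤ) (hl : 0 ≤ i) (hu : i ≤ k - 3) (hd : d = 2 * k - 2 - 2 * i) (ha : a = 2 * k - 2 - i)
      (hc : c = 0) (hc' : c' = 0)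
  | piece_c (hd : d = 2) (ha : a = k + 1) (hc : c = 1) (hc' : c' = 0)
  | piece_d (i : ℤ) (hl : 1 ≤ i) (hu : i ≤ k - 2) (hd : d = 2 * k - 1 - 2 * i) (ha : a = 2 * k - i)
      (hc : c = 1) (hc' : c' = 1)
  | piece_e (hd : d = 1) (ha : a = k - 1) (hc : c = 0) (hc' : c' = 0)
  | piece_f (i : ℤ) (hl : 0 ≤ i) (hu : i ≤ k - 2) (hd : d = 2 * i + 1 - 2 * k) (ha : a = i)
      (hc : c = 0) (hc' : c' = 0)
  | piece_g (i : ℤ) (hl : 1 ≤ i) (hu : i ≤ k - 1) (hd : d = 2 * i - 2 * k) (ha : a = i)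
      (hc : c = 1) (hc' : c' = 1)
  | piece_h (hd : d = -1) (ha : a = 0) (hc : c = 1) (hc' : c' = 1)

/-- The same parity obstruction occurs for odd `k`, so the positive and negative zigzags again
differ and balance only jointly. -/
theorem exists_gracefulLabelling_two_mul (k : ℤ) (hk : 3 ≤ k) :
    ∃ g a c c', IsGracefulLabelling (2 * k) g a c c' := by
  have hex : ∀ d, -(2 * k) < d → d < 2 * k → d ≠ 0 → ∃ a c c', LabelRelationTwoMul k d a c c' := by
    intro d h1 h2 h3
    by_contra! hno
    have h_piece_a : ¬(d = 2 * k - 1) := fun _ =>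
      hno _ _ _ (.piece_a (by omega) rfl rfl rfl)
    have h_piece_b : ¬(2 < d ∧ d % 2 = 0) := fun _ =>
      hno _ _ _ (.piece_b ((2 * k - 2 - d) / 2) (by omega) (by omega) (by omega) rfl rfl rfl)
    have h_piece_c : ¬(d = 2) := fun _ =>
      hno _ _ _ (.piece_c (by omega) rfl rfl rfl)
    have h_piece_d : ¬(1 < d ∧ d < 2 * k - 1 ∧ d % 2 = 1) := fun _ =>
      hno _ _ _ (.piece_d ((2 * k - 1 - d) / 2) (by omega) (by omega) (by omega) rfl rfl rfl)
    have h_piece_e : ¬(d = 1) := fun _ =>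
      hno _ _ _ (.piece_e (by omega) rfl rfl rfl)
    have h_piece_f : ¬(d < -1 ∧ d % 2 = 1) := fun _ =>
      hno _ _ _ (.piece_f ((2 * k - 1 + d) / 2) (by omega) (by omega) (by omega) rfl rfl rfl)
    have h_piece_g : ¬(d < 0 ∧ d % 2 = 0) := fun _ =>
      hno _ _ _ (.piece_g ((2 * k + d) / 2) (by omega) (by omega) (by omega) rfl rfl rfl)
    have h_piece_h : ¬(d = -1) := fun _ =>
      hno _ _ _ (.piece_h (by omega) rfl rfl rfl)
    clear hno
    omega
  choose! a c c' h using hex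
  refine ⟨k, a, c, c', ?_, ?_, ?_, ?_, by omega⟩
  · intro d h1 h2 h3
    cases h d h1 h2 h3 <;> omega
  · intro d h1 h2 h3
    cases h d h1 h2 h3 <;> omega
  · intro d e h1 h2 h3 h1' h2' h3' hae hce
    cases h d h1 h2 h3 <;> cases h e h1' h2' h3' <;> omega
  · intro d e h1 h2 h3 h1' h2' h3' hae hce
    cases h d h1 h2 h3 <;> cases h e h1' h2' h3' <;> omega

theorem exists_gracefulLabelling (t : ℤ) (ht : 5 ≤ t) :
    ∃ g a c c', IsGracefulLabelling t g a c c' := by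
  obtain h | h | h : t = 4 * (t / 4) + 1 ∨ t = 4 * (t / 4) + 3 ∨ t = 2 * (t / 2) := by omega
  · rw [h]; exact exists_gracefulLabelling_four_mul_add_one _ (by omega)
  · rw [h]; exact exists_gracefulLabelling_four_mul_add_three _ (by omega)
  · rw [h]; exact exists_gracefulLabelling_two_mul _ (by omega)

/-! ### Reduction to three injections avoiding the hole. -/

theorem dvd_of_intCast_mem_holeSet {w t : ℕ} {z : ℤ} (h : (z : ZMod (w * t)) ∈ holeSet w t) :
    (t : ℤ) ∣ z := by
  obtain ⟨i, -, hi⟩ := h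
  have h1 : (z : ZMod (w * t)) = ((i * t : ℤ) : ZMod (w * t)) := by rw [hi]; push_cast; rfl
  rw [ZMod.intCast_eq_intCast_iff_dvd_sub] at h1
  have h2 : (t : ℤ) ∣ i * t - z := (Dvd.intro_left (w : ℤ) (by push_cast; rfl)).trans h1
  simpa using (Dvd.intro_left (i : ℤ) rfl).sub h2

theorem le_ncard_holeSet {w t : ℕ} (ht : 0 < t) : w ≤ (holeSet w t).ncard := by
  rcases Nat.eq_zero_or_pos w with rfl | hw
  · simp
  have : NeZero (w * t) := ⟨(Nat.mul_pos hw ht).ne'⟩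
  let f : ℕ → ZMod (w * t) := fun i => ((i * t : ℕ) : ZMod (w * t))
  have himg : f '' (Set.Iio w) ⊆ holeSet w t := by
    rintro _ ⟨i, hi, rfl⟩
    exact ⟨i, hi, rfl⟩
  have hinj : Set.InjOn f (Set.Iio w) := by
    intro i hi j hj hij
    have h1 := (ZMod.natCast_eq_natCast_iff' _ _ _).1 hij
    rw [Nat.mod_eq_of_lt (Nat.mul_lt_mul_of_pos_right hi ht),
      Nat.mod_eq_of_lt (Nat.mul_lt_mul_of_pos_right hj ht)] at h1
    exact Nat.eq_of_mul_eq_mul_right ht h1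
  calc w = (f '' (Set.Iio w)).ncard := by rw [hinj.ncard_image]; simp
    _ ≤ _ := Set.ncard_le_ncard himg (Set.toFinite _)

/-- The complement of the hole has at most `w * t - w = w * (t - 1)` elements, so an injection into
it is onto. -/
theorem existsUnique_of_injective_of_notMem_holeSet {w t : ℕ} (hw : 0 < w) (ht : 0 < t)
    (f : Fin (w * (t - 1)) → ZMod (w * t)) (hf : Function.Injective f)
    (hS : ∀ j, f j ∉ holeSet w t) (d : ZMod (w * t)) (hd : d ∉ holeSet w t) :
    ∃! j, f j = d := by
  have : NeZero (w * t) := ⟨(Nat.mul_pos hw ht).ne'⟩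
  have hsub : Set.range f ⊆ (holeSet w t)ᶜ := by
    rintro _ ⟨j, rfl⟩
    exact hS j
  have hcard : ((holeSet w t)ᶜ).ncard ≤ (Set.range f).ncard := by
    have h1 := Set.ncard_add_ncard_compl (holeSet w t)
    have h2 := le_ncard_holeSet (w := w) ht
    rw [Nat.card_eq_fintype_card, ZMod.card] at h1
    rw [← Set.image_univ, Set.ncard_image_of_injective _ hf, Set.ncard_univ,
      Nat.card_eq_fintype_card, Fintype.card_fin, Nat.mul_sub_one]
    omega
  have heq := Set.eq_of_subset_of_ncard_le hsub hcard (Set.toFinite _)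
  obtain ⟨j, hj⟩ : d ∈ Set.range f := by rw [heq]; exact hd
  exact ⟨j, hj, fun i hi => hf (hi.trans hj.symm)⟩

/-- A `3`-row cyclic holey difference matrix from three injections avoiding the hole, the third
being the sum of the first two. -/
theorem exists_isCHDM_three_of_injective {w t : ℕ} (hw : 0 < w) (ht : 0 < t)
    (X Y : Fin (w * (t - 1)) → ℤ)
    (hX : ∀ i j, ((w * t : ℕ) : ℤ) ∣ X i - X j → i = j) (hX' : ∀ j, ¬ (t : ℤ) ∣ X j)
    (hY : ∀ i j, ((w * t : ℕ) : ℤ) ∣ Y i - Y j → i = j) (hY' : ∀ j, ¬ (t : ℤ) ∣ Y j)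
    (hZ : ∀ i j, ((w * t : ℕ) : ℤ) ∣ (X i + Y i) - (X j + Y j) → i = j)
    (hZ' : ∀ j, ¬ (t : ℤ) ∣ X j + Y j) :
    ∃ D : Matrix (Fin 3) (Fin (w * (t - 1))) (ZMod (w * t)), IsCHDM 3 w t D := by
  let R : Fin 3 → Fin (w * (t - 1)) → ℤ := ![fun _ => 0, X, fun j => -Y j]
  have key : ∀ x y : Fin 3, x ≠ y →
      (∀ i j, ((w * t : ℕ) : ℤ) ∣ (R x i - R y i) - (R x j - R y j) → i = j) ∧
      ∀ j, ¬ (t : ℤ) ∣ R x j - R y j := by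
    have hsymm : ∀ x y : Fin 3,
        ((∀ i j, ((w * t : ℕ) : ℤ) ∣ (R x i - R y i) - (R x j - R y j) → i = j) ∧
          ∀ j, ¬ (t : ℤ) ∣ R x j - R y j) →
        (∀ i j, ((w * t : ℕ) : ℤ) ∣ (R y i - R x i) - (R y j - R x j) → i = j) ∧
          ∀ j, ¬ (t : ℤ) ∣ R y j - R x j := by
      rintro x y ⟨h1, h2⟩
      refine ⟨fun i j h => h1 i j ?_, fun j h => h2 j ?_⟩
      · rw [← dvd_neg]
        rwa [show -(R x i - R y i - (R x j - R y j)) = R y i - R x i - (R y j - R x j) by ring]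
      · rwa [← dvd_neg, neg_sub]
    have h10 : (∀ i j, ((w * t : ℕ) : ℤ) ∣ (R 1 i - R 0 i) - (R 1 j - R 0 j) → i = j) ∧
        ∀ j, ¬ (t : ℤ) ∣ R 1 j - R 0 j := by
      simpa [R] using And.intro hX hX'
    have h02 : (∀ i j, ((w * t : ℕ) : ℤ) ∣ (R 0 i - R 2 i) - (R 0 j - R 2 j) → i = j) ∧
        ∀ j, ¬ (t : ℤ) ∣ R 0 j - R 2 j := by
      simpa [R] using And.intro hY hY'
    have h12 : (∀ i j, ((w * t : ℕ) : ℤ) ∣ (R 1 i - R 2 i) - (R 1 j - R 2 j) → i = j) ∧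
        ∀ j, ¬ (t : ℤ) ∣ R 1 j - R 2 j := by
      simpa [R] using And.intro hZ hZ'
    intro x y hxy
    fin_cases x <;> fin_cases y <;> first
      | exact absurd rfl hxy
      | exact h10
      | exact h02
      | exact h12
      | exact hsymm _ _ h10
      | exact hsymm _ _ h02
      | exact hsymm _ _ h12
  refine ⟨fun x j => (R x j : ZMod (w * t)), fun x y hxy => ?_⟩
  obtain ⟨h1, h2⟩ := key x y hxy
  have h3 : ∀ j, ((R x j : ZMod (w * t)) - (R y j : ZMod (w * t))) ∉ holeSet w t := by
    intro j hj
    rw [← Int.cast_sub] at hj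
    exact h2 j (dvd_of_intCast_mem_holeSet hj)
  refine ⟨fun d hd => existsUnique_of_injective_of_notMem_holeSet hw ht
    (fun j => (R x j : ZMod (w * t)) - (R y j : ZMod (w * t))) ?_ h3 d hd, ?_⟩
  · intro i j hij
    refine (h1 j i ?_).symm
    rw [← ZMod.intCast_eq_intCast_iff_dvd_sub]
    push_cast
    exact hij
  · rintro d hd j rfl
    exact h3 j hd

/-! ### From a labelling to the matrix. -/

theorem Int.eq_of_dvd_sub_of_abs_sub_lt {n a b : ℤ} (h : n ∣ a - b) (hlt : |a - b| < n) :
    a = b :=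
  sub_eq_zero.1 (Int.eq_zero_of_abs_lt_dvd h hlt)

theorem exists_isCHDM_three_of_gracefulLabelling {m t : ℕ} (hm : 0 < m) (hm2 : Even m)
    (ht : 0 < t) {g : ℤ} {a c c' : ℤ → ℤ} (H : IsGracefulLabelling t g a c c') :
    ∃ D : Matrix (Fin 3) (Fin (2 * m * (t - 1))) (ZMod (2 * m * t)), IsCHDM 3 (2 * m) t D := by
  let I : Finset ℤ := (Finset.Ioo (-(t : ℤ)) t).erase 0
  have hI : ∀ d : I, -(t : ℤ) < d.1 ∧ d.1 < t ∧ d.1 ≠ 0 := by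
    rintro ⟨d, hd⟩
    simp only [I, Finset.mem_erase, Finset.mem_Ioo] at hd
    exact ⟨hd.2.1, hd.2.2, hd.1⟩
  have hcard : Fintype.card (I × Fin m) = 2 * m * (t - 1) := by
    have h0 : (0 : ℤ) ∈ Finset.Ioo (-(t : ℤ)) t := by simp; omega
    have h1 : I.card = 2 * (t - 1) := by
      rw [Finset.card_erase_of_mem h0, Int.card_Ioo]; omega
    rw [Fintype.card_prod, Fintype.card_coe, Fintype.card_fin, h1]; ring
  let e : Fin (2 * m * (t - 1)) ≃ I × Fin m := (Fintype.equivFinOfCardEq hcard).symm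
  have htZ : (t : ℤ) ≠ 0 := by omega
  have hNm : ((2 * m * t : ℕ) : ℤ) = t * (2 * m) := by push_cast; ring
  -- the level of a column is determined by its residue modulo `2 m`
  have hlevel : ∀ (i j : Fin m) (p q : ℤ), (p = 0 ∨ p = 1) → (q = 0 ∨ q = 1) →
      (t : ℤ) * (2 * m) ∣ t * (i.1 + m * p) - t * (j.1 + m * q) → i = j ∧ p = q := by
    intro i j p q hp hq h
    rw [← mul_sub] at h
    have h1 := Int.dvd_of_mul_dvd_mul_left htZ h
    have hi := i.2
    have hj := j.2
    have h2 := Int.eq_of_dvd_sub_of_abs_sub_lt h1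
      (by rw [abs_lt]; rcases hp with rfl | rfl <;> rcases hq with rfl | rfl <;>
            constructor <;> omega)
    rcases hp with rfl | rfl <;> rcases hq with rfl | rfl <;>
      refine ⟨Fin.ext ?_, ?_⟩ <;> omega
  -- Reducing modulo `t` recovers the label.
  have hres : ∀ u v p q : ℤ, 0 ≤ u → u < t → 0 ≤ v → v < t →
      (t : ℤ) * (2 * m) ∣ (u - g + t * p) - (v - g + t * q) → u = v := by
    intro u v p q hu hu' hv hv' h
    refine Int.eq_of_dvd_sub_of_abs_sub_lt (n := t) ?_ (by rw [abs_lt]; constructor <;> omega)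
    have h1 : (t : ℤ) ∣ (u - g + t * p) - (v - g + t * q) := (Dvd.intro _ rfl).trans h
    have h2 := h1.sub (Dvd.intro (p - q) rfl : (t : ℤ) ∣ t * (p - q))
    rwa [show u - g + t * p - (v - g + t * q) - t * (p - q) = u - v by ring] at h2
  have hne : ∀ u p : ℤ, 0 ≤ u → u < t → u ≠ g → ¬ (t : ℤ) ∣ u - g + t * p := by
    intro u p hu hu' hug h
    have hg := H.range_pos
    rw [dvd_add_left (Dvd.intro _ rfl)] at h
    exact hug (Int.eq_of_dvd_sub_of_abs_sub_lt h (by rw [abs_lt]; constructor <;> omega))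
  refine exists_isCHDM_three_of_injective (by omega) ht
    (fun j => a (e j).1 - g + t * ((e j).2 + m * c (e j).1))
    (fun j => -(a (e j).1 - (e j).1 - g + t * (-((e j).2 : ℤ) - m * c' (e j).1)))
    ?_ ?_ ?_ ?_ ?_ ?_
  · intro i j h
    rw [hNm] at h
    apply e.injective
    generalize e i = p at h ⊢
    generalize e j = q at h ⊢
    obtain ⟨d, i⟩ := p
    obtain ⟨d', j⟩ := q
    dsimp only at h
    obtain ⟨h1, h2, h3⟩ := hI d
    obtain ⟨h1', h2', h3'⟩ := hI d'
    have hd := H.minuend d h1 h2 h3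
    have hd' := H.minuend d' h1' h2' h3'
    have hu := hres _ _ _ _ hd.1 hd.2.1 hd'.1 hd'.2.1 h
    obtain ⟨hij, hc⟩ := hlevel i j _ _ hd.2.2.2 hd'.2.2.2
      (by rw [hu] at h; simpa using h)
    exact Prod.ext (Subtype.ext (H.minuend_inj _ _ h1 h2 h3 h1' h2' h3' hu hc)) hij
  · intro j
    obtain ⟨h1, h2, h3⟩ := hI (e j).1
    have hd := H.minuend _ h1 h2 h3
    exact hne _ _ hd.1 hd.2.1 hd.2.2.1
  · intro i j h
    rw [hNm] at h
    apply e.injective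
    generalize e i = p at h ⊢
    generalize e j = q at h ⊢
    obtain ⟨d, i⟩ := p
    obtain ⟨d', j⟩ := q
    dsimp only at h
    obtain ⟨h1, h2, h3⟩ := hI d
    obtain ⟨h1', h2', h3'⟩ := hI d'
    have hd := H.subtrahend d h1 h2 h3
    have h' := h
    rw [← neg_sub', dvd_neg] at h'
    have hd' := H.subtrahend d' h1' h2' h3'
    have hu := hres _ _ _ _ hd.1 hd.2.1 hd'.1 hd'.2.1
      h'
    obtain ⟨hij, hc⟩ := hlevel i j _ _ hd.2.2.2 hd'.2.2.2
      (by
        rw [hu, ← dvd_neg] at h'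
        ring_nf at h' ⊢
        exact h')
    exact Prod.ext (Subtype.ext (H.subtrahend_inj _ _ h1 h2 h3 h1' h2' h3' hu hc)) hij
  · intro j
    rw [dvd_neg]
    obtain ⟨h1, h2, h3⟩ := hI (e j).1
    have hd := H.subtrahend _ h1 h2 h3
    exact hne _ _ hd.1 hd.2.1 hd.2.2.1
  · intro i j h
    rw [hNm] at h
    apply e.injective
    generalize e i = p at h ⊢
    generalize e j = q at h ⊢
    obtain ⟨d, i⟩ := p
    obtain ⟨d', j⟩ := q
    dsimp only at h
    obtain ⟨h1, h2, h3⟩ := hI d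
    obtain ⟨h1', h2', h3'⟩ := hI d'
    obtain ⟨n, hn⟩ := hm2
    have hn' : (m : ℤ) = 2 * n := by omega
    -- Since `m` is even, the sum is congruent to `d` modulo `2 * t`, and integers in `(-t, t)` are
    -- distinct modulo `2 * t`.
    have hdd : d.1 = d'.1 := by
      refine Int.eq_of_dvd_sub_of_abs_sub_lt (n := 2 * t) ?_
        (by rw [abs_lt]; constructor <;> omega)
      have h4 : (2 * t : ℤ) ∣ t * (2 * m) := ⟨m, by ring⟩
      have h5 := (h4.trans h).sub (Dvd.intro ((i : ℤ) - j +
        n * (c d.1 + c' d.1 - c d'.1 - c' d'.1)) rfl : (2 * t : ℤ) ∣ 2 * t * _)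
      rw [hn'] at h5
      ring_nf at h5 ⊢
      exact h5
    obtain rfl : d = d' := Subtype.ext hdd
    -- With `d` equal, the `c` and `c'` terms cancel, leaving `i` modulo `m`.
    have h6 : (2 * t : ℤ) * m ∣ 2 * t * (i - j) := by
      rw [show (2 * t : ℤ) * m = t * (2 * m) by ring]
      ring_nf at h ⊢
      exact h
    have h7 := Int.dvd_of_mul_dvd_mul_left (by omega) h6
    have hi := i.2
    have hj := j.2
    have h8 := Int.eq_of_dvd_sub_of_abs_sub_lt h7 (by rw [abs_lt]; constructor <;> omega)
    exact Prod.ext rfl (Fin.ext (by exact_mod_cast h8))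
  · intro j h
    obtain ⟨h1, h2, h3⟩ := hI (e j).1
    have h4 := h.sub (Dvd.intro (2 * ((e j).2 : ℤ) + m * (c (e j).1 + c' (e j).1)) rfl :
      (t : ℤ) ∣ t * _)
    refine h3 (Int.eq_zero_of_abs_lt_dvd (m := t) ?_ (by rw [abs_lt]; exact ⟨h1, h2⟩))
    ring_nf at h4
    exact h4

theorem lemma5p3 (x t : ℕ) (hx : 3 ≤ x) (ht : 5 ≤ t) :
    ∃ D : Matrix (Fin 3) (Fin (2 ^ x * (t - 1))) (ZMod (2 ^ x * t)), IsCHDM 3 (2 ^ x) t D := by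
  obtain ⟨g, a, c, c', H⟩ := exists_gracefulLabelling t (by exact_mod_cast ht)
  obtain ⟨y, rfl⟩ : ∃ y, x = y + 1 := ⟨x - 1, by omega⟩
  rw [pow_succ']
  exact exists_isCHDM_three_of_gracefulLabelling (by positivity)
    (even_two.pow_of_ne_zero (by omega)) (by omega) H
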